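/- **Setting.** Let $G=(V,E)$ be a finite undirected simple graph with $n=|V|\ge 3$ and real edge lengths at least $1$; let $d\ge 2$ be an integer, $c\ge 1$ and $\epsilon>0$ real, and let $D\subseteq V$ with $|D|\le d$. Put $k=\ln n$, $\epsilon_1=\frac{\epsilon}{2+\epsilon}$, $\epsilon_5=\frac{\epsilon_1}{4k-2}$. Write $|P|$ for the length of a path $P$, $\delta_F$ for the distance in a graph $F$, and $\pi_F(x,y)$ for a shortest $x$-$y$ path in $F$. (Shortest paths need not be unique; the statement holds for every choice. If there is no $x$-$y$ path in $F$, then $\pi_F(x,y)$ does not exist.) $P_1\circ P_2$ is the concatenation of $P_1$ and $P_2$; as it may visit a vertex twice, the vertices of a path are always referred to by their positions on it. *Tree covers.* For disjoint $R,S\subseteq V$, an $S$-restricted tree cover of $G-R$ consists of one tree $T(r)\subseteq G-R$ rooted at $r$ for each $r\in S$, such that (i) for all $x\in S$ and all $y$ connected to $x$ in $G-R$ there is $r\in S$ with $x,y\in V(T(r))$ and $\mathrm{dep}_{T(r)}(x)+\mathrm{dep}_{T(r)}(y)\le(2k-1)\,\delta_{G-R}(x,y)$, where $\mathrm{dep}$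 is the weighted distance to the root in the tree; and (ii) every vertex is in at most $kn^{1/k}(\ln n+1)$ of the trees. Fix any choice of such covers, one for each pair of disjoint $R,S$; for arbitrary $R,S\subseteq V$ let $\mathcal T_R(S)$ be the chosen $(S\setminus R)$-restricted cover of $G-R$, and $\mathcal T(S)=\mathcal T_\emptyset(S)$. For a tree $T$ of $\mathcal T_R(S)$, a *trunk vertex* of $T$ is a vertex of $T$ on the $T$-path between two vertices of $S\setminus R$. The pseudo-degree of $v$ in $T$ is the number of trunk vertices adjacent to $v$ in $T$ if $v$ is a trunk vertex, and $0$ otherwise. Let $\mathrm{Hi}(\mathcal T_R(S))$ be the set of vertices whose pseudo-degree in some tree of $\mathcal T_R(S)$ exceeds $4e\,d^{c+1}\ln^2 n+1$. *Hierarchy.* The hierarchy tree has root $V$. A node $U$ with $\mathrm{Hi}(\mathcal T(U))=\emptyset$ is a leaf; any other node $U$ has the children $W_1,\dots,W_d$, where $W_1=\mathrm{Hi}(\mathcal T(U))$ and $W_i=W_{i-1}\cup\mathrm{Hi}(\mathcal T_{W_{i-1}}(U))$ for $2\le i\le d$. Fix any path $V=U_1,U_2,\dots,U_p$ ($p\ge1$)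 in this tree starting at the root, and put $U_{p+1}=\emptyset$. The level of a vertex $v$ is the largest $l\le p$ with $v\in U_l$, and $G_l$ is the subgraph of $G$ induced by the vertices of level at most $l$. *The set $V(H)$.* For $f\in D$ let $N(f)$ be the set of all vertices that, in some tree $T\ni f$ belonging to $\bigcup_{i=1}^p\mathcal T_{U_{i+1}}(U_i)$, are the parent of $f$ or are a child of $f$ and a trunk vertex of $T$. For given query vertices $s,t\in V$ put $V(H)=\bigl(\{s,t\}\cup\bigcup_{f\in D}N(f)\bigr)\setminus D$. *Far-away paths.* A path $P$ from $a$ to $b$ is $\epsilon_1$-far away from $V(H)$ if there are no inner position of $P$, with vertex $x$, and no $z\in V(H)$ connected to $x$ in $G-D$ such that $|\pi_{G-D}(x,z)|\le\epsilon_1\min\{|P[a,x]|,|P[x,b]|\}$. *Segments.* Two inner positions $x,y$ of a path $P$ from $a$ to $b$ are in the same $\epsilon_5$-segment if either $|P[a,x]|,|P[a,y]|\le|P|/2$ and $\lfloor\log_{1+\epsilon_5}|P[a,x]|\rfloor=\lfloor\log_{1+\epsilon_5}|P[a,y]|\rfloor$, or $|P[x,b]|,|P[y,b]|<|P|/2$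 and $\lfloor\log_{1+\epsilon_5}|P[x,b]|\rfloor=\lfloor\log_{1+\epsilon_5}|P[y,b]|\rfloor$. An $\epsilon_5$-segment of $P$ is the subpath from the leftmost to the rightmost position of a class of this relation. $P$ is an *$\epsilon_5$-segment bipath* if for each of its $\epsilon_5$-segments $P[x,y]$ there are levels $1\le i,j\le p$ and a vertex $z$ on $P[x,y]$ such that $P[x,y]$ is the concatenation of a shortest $x$-$z$ path in $G_i$ and a shortest $z$-$y$ path in $G_j$. **Theorem.** Let $s,t,u,v,w\in V$ and let $P=\pi_{G-D}(u,v)\circ\pi_{G-D}(v,w)$. If $P$ is $\epsilon_1$-far away from $V(H)$, then $P$ is an $\epsilon_5$-segment bipath. -/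

import Mathlib

open SimpleGraph

namespace VSDO

noncomputable section

/-! ### Weighted walks and shortest paths in induced subgraphs -/

/-- The length `|P|` of a walk `P`: the sum of the lengths of the edges it traverses. -/
def wlen {V : Type*} (wt : Sym2 V → ℝ) {H : SimpleGraph V} {x y : V} (P : H.Walk x y) : ℝ :=
  (P.edges.map wt).sum

/-- `P` is a shortest path from `x` to `y` in the induced subgraph `G[A]`: it uses vertices of `A`
only, and no walk of `G` inside `A` from `x` to `y` is shorter. -/
def IsShortestIn {V : Type*} (G : SimpleGraph V) (wt : Sym2 V → ℝ) (A : Set V) {x y : V}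
    (P : G.Walk x y) : Prop :=
  (∀ a ∈ P.support, a ∈ A) ∧
    ∀ Q : G.Walk x y, (∀ a ∈ Q.support, a ∈ A) → wlen wt P ≤ wlen wt Q

/-! ### Rooted trees -/

/-- `T` is a tree (a subgraph of `G`) and `r` is one of its vertices. -/
def IsRootedTree {V : Type*} {G : SimpleGraph V} (T : G.Subgraph) (r : V) : Prop :=
  T.coe.IsTree ∧ r ∈ T.verts

/-- In the tree `T` rooted at `r`, the vertex `x` has (weighted) depth `a`. -/
def HasDepth {V : Type*} {G : SimpleGraph V} (wt : Sym2 V → ℝ) (T : G.Subgraph) (r x : V)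
    (a : ℝ) : Prop :=
  x ∈ T.verts ∧ ∃ P : T.spanningCoe.Walk x r, P.IsPath ∧ wlen wt P = a

/-- In the tree `T` rooted at `r`, the vertex `g` is the parent of `f`: the second vertex of the
tree path from `f` to `r`. -/
def IsParent {V : Type*} {G : SimpleGraph V} (T : G.Subgraph) (r f g : V) : Prop :=
  ∃ P : T.spanningCoe.Walk f r, P.IsPath ∧ 0 < P.length ∧ P.getVert 1 = g

/-- The trunk vertices of `T` with respect to the source set `S`: the vertices of `T` that lie on
the path in `T` between two vertices of `S`. -/
def trunk {V : Type*} {G : SimpleGraph V} (T : G.Subgraph) (S : Set V) : Set V :=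
  {v | v ∈ T.verts ∧ ∃ a ∈ S, ∃ b ∈ S, ∃ P : T.spanningCoe.Walk a b, P.IsPath ∧ v ∈ P.support}

/-- The pseudo-degree of `v` in `T`: its degree in the subgraph of `T` induced by the trunk
vertices, and `0` if `v` is not a trunk vertex. -/
def pdeg {V : Type*} {G : SimpleGraph V} (T : G.Subgraph) (S : Set V) (v : V) : ℕ :=
  {g | v ∈ trunk T S ∧ g ∈ trunk T S ∧ T.Adj v g}.ncard

/-! ### Source-restricted tree covers -/

/-- The parameter `k = ln n`, where `n` is the number of vertices of the input graph. -/
def kpar (V : Type*) [Fintype V] : ℝ := Real.log (Fintype.card V)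

/-- `T` is an `S`-restricted tree cover of `G - R`: a tree `T r` in `G - R` rooted at `r` for every
`r ∈ S`, such that for all `x ∈ S` and all `y` connected to `x` in `G - R` some tree contains both
and `dep x + dep y ≤ (2k - 1) δ_{G-R}(x, y)`, and such that no vertex is in more than
`k n^{1/k} (ln n + 1)` trees. -/
structure IsTreeCover {V : Type*} [Fintype V] (G : SimpleGraph V) (wt : Sym2 V → ℝ) (R S : Set V)
    (T : V → G.Subgraph) : Prop where
  tree : ∀ r ∈ S, IsRootedTree (T r) r ∧ (T r).verts ⊆ Rᶜ
  stretch : ∀ x ∈ S, ∀ y, ∀ P : G.Walk x y, IsShortestIn G wt Rᶜ P →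
    ∃ r ∈ S, ∃ a b : ℝ, HasDepth wt (T r) r x a ∧ HasDepth wt (T r) r y b ∧
      a + b ≤ (2 * kpar V - 1) * wlen wt P
  overlap : ∀ v, (({r | r ∈ S ∧ v ∈ (T r).verts}.ncard : ℕ) : ℝ) ≤
    kpar V * (Fintype.card V : ℝ) ^ (1 / kpar V) * (Real.log (Fintype.card V) + 1)

/-- A choice, for all `R` and all `S ⊆ V \ R`, of an `S`-restricted tree cover `cov R S` of `G - R`.
The cover `𝒯_R(S)` is then `cov R (S \ R)`, and `𝒯(S)` is `cov ∅ S`. -/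
def IsCoverChoice {V : Type*} [Fintype V] (G : SimpleGraph V) (wt : Sym2 V → ℝ)
    (cov : Set V → Set V → V → G.Subgraph) : Prop :=
  ∀ R S : Set V, Disjoint S R → IsTreeCover G wt R S (cov R S)

/-! ### The high-degree hierarchy -/

/-- The degree threshold `s = 4 e d^{c+1} ln² n + 1`. -/
def threshold (V : Type*) [Fintype V] (d : ℕ) (c : ℝ) : ℝ :=
  4 * Real.exp 1 * (d : ℝ) ^ (c + 1) * Real.log (Fintype.card V) ^ 2 + 1

/-- `Hi(𝒯_R(S))`: the vertices whose pseudo-degree in some tree of `𝒯_R(S)` exceeds the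
threshold. -/
def Hi {V : Type*} [Fintype V] {G : SimpleGraph V} (d : ℕ) (c : ℝ)
    (cov : Set V → Set V → V → G.Subgraph) (R S : Set V) : Set V :=
  {v | ∃ r ∈ S \ R, threshold V d c < (pdeg (cov R (S \ R) r) (S \ R) v : ℝ)}

/-- The sets `W_0 = ∅`, `W_1 = Hi(𝒯(U))`, `W_{j+1} = W_j ∪ Hi(𝒯_{W_j}(U))`; for `1 ≤ j ≤ d`
these are the children of the node `U` of the hierarchy tree, if `U` is not a leaf. -/
def childSet {V : Type*} [Fintype V] {G : SimpleGraph V} (d : ℕ) (c : ℝ)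
    (cov : Set V → Set V → V → G.Subgraph) (U : Set V) : ℕ → Set V
  | 0 => ∅
  | j + 1 => childSet d c cov U j ∪ Hi d c cov (childSet d c cov U j) U

/-- `U_1 = V, U_2, …, U_p` is a path in the hierarchy tree that starts in the root, and
`U_{p+1} = ∅` by convention. (A node `U` with `Hi(𝒯(U)) = ∅` is a leaf.) -/
structure IsHierarchyPath {V : Type*} [Fintype V] {G : SimpleGraph V} (d : ℕ) (c : ℝ)
    (cov : Set V → Set V → V → G.Subgraph) (p : ℕ) (U : ℕ → Set V) : Prop where
  one_le : 1 ≤ p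
  root : U 1 = Set.univ
  child : ∀ i, 1 ≤ i → i < p →
    (Hi d c cov ∅ (U i)).Nonempty ∧ ∃ j, 1 ≤ j ∧ j ≤ d ∧ U (i + 1) = childSet d c cov (U i) j
  last : U (p + 1) = ∅

/-- The level of `v`: the largest `l` with `v ∈ U_l`. -/
def level {V : Type*} (p : ℕ) (U : ℕ → Set V) (v : V) : ℕ :=
  sSup {l | 1 ≤ l ∧ l ≤ p ∧ v ∈ U l}

/-- The vertex set of `G_i`, the subgraph of `G` induced by the vertices of level at most `i`. -/
def lowVerts {V : Type*} (p : ℕ) (U : ℕ → Set V) (i : ℕ) : Set V :=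
  {v | level p U v ≤ i}

/-! ### The vertex set of the auxiliary graph -/

/-- `N_T(f)` for the tree `T` rooted at `r`, with source set `S`: the parent of `f` and those
children of `f` that are trunk vertices. -/
def treeNbrs {V : Type*} {G : SimpleGraph V} (T : G.Subgraph) (S : Set V) (r f : V) : Set V :=
  {g | IsParent T r f g ∨ (IsParent T r g f ∧ g ∈ trunk T S)}

/-- `N(f)`: the union of `N_T(f)` over all trees `T ∋ f` of `𝒯_{U_{i+1}}(U_i)`, `1 ≤ i ≤ p`. -/
def failNbrs {V : Type*} {G : SimpleGraph V} (cov : Set V → Set V → V → G.Subgraph) (p : ℕ)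
    (U : ℕ → Set V) (f : V) : Set V :=
  {g | ∃ i, 1 ≤ i ∧ i ≤ p ∧ ∃ r ∈ U i \ U (i + 1),
    f ∈ (cov (U (i + 1)) (U i \ U (i + 1)) r).verts ∧
    g ∈ treeNbrs (cov (U (i + 1)) (U i \ U (i + 1)) r) (U i \ U (i + 1)) r f}

/-- `V(H)` for the query with end vertices `s`, `t` and failure set `D`. -/
def auxVerts {V : Type*} {G : SimpleGraph V} (cov : Set V → Set V → V → G.Subgraph) (p : ℕ)
    (U : ℕ → Set V) (D : Set V) (s t : V) : Set V :=
  ({s, t} ∪ ⋃ f ∈ D, failNbrs cov p U f) \ D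

/-! ### Segments, far-away paths, segment bipaths

The vertices of a path are addressed by their positions, as a path may visit a vertex twice. -/

/-- The inner positions `i` and `j` of `P` are in the same `ε`-segment of `P`. -/
def SameSegment {V : Type*} {G : SimpleGraph V} (wt : Sym2 V → ℝ) (ε : ℝ) {x y : V}
    (P : G.Walk x y) (i j : ℕ) : Prop :=
  (0 < i ∧ i < P.length) ∧ (0 < j ∧ j < P.length) ∧
    ((wlen wt (P.take i) ≤ wlen wt P / 2 ∧ wlen wt (P.take j) ≤ wlen wt P / 2 ∧
        ⌊Real.logb (1 + ε) (wlen wt (P.take i))⌋ = ⌊Real.logb (1 + ε) (wlen wt (P.take j))⌋) ∨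
      (wlen wt (P.drop i) < wlen wt P / 2 ∧ wlen wt (P.drop j) < wlen wt P / 2 ∧
        ⌊Real.logb (1 + ε) (wlen wt (P.drop i))⌋ = ⌊Real.logb (1 + ε) (wlen wt (P.drop j))⌋))

/-- `l` and `r` are the leftmost and the rightmost position of an `ε`-segment of `P`. -/
def IsSegment {V : Type*} {G : SimpleGraph V} (wt : Sym2 V → ℝ) (ε : ℝ) {x y : V}
    (P : G.Walk x y) (l r : ℕ) : Prop :=
  SameSegment wt ε P l r ∧ ∀ m, SameSegment wt ε P l m → l ≤ m ∧ m ≤ r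

/-- `P` is `ε`-far away from the vertex set `X` (with respect to distances in `G - D`). -/
def FarAway {V : Type*} {G : SimpleGraph V} (wt : Sym2 V → ℝ) (D X : Set V) (ε : ℝ) {x y : V}
    (P : G.Walk x y) : Prop :=
  ¬ ∃ m, 0 < m ∧ m < P.length ∧ ∃ z ∈ X, ∃ Q : G.Walk (P.getVert m) z,
    IsShortestIn G wt Dᶜ Q ∧ wlen wt Q ≤ ε * min (wlen wt (P.take m)) (wlen wt (P.drop m))

/-- `P` is an `ε`-segment bipath: every `ε`-segment of `P` is the concatenation of a shortest path
in `G_i` and a shortest path in `G_j` for two levels `i`, `j`. -/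
def IsSegmentBipath {V : Type*} {G : SimpleGraph V} (wt : Sym2 V → ℝ) (p : ℕ) (U : ℕ → Set V)
    (ε : ℝ) {x y : V} (P : G.Walk x y) : Prop :=
  ∀ l r, IsSegment wt ε P l r →
    ∃ i j, (1 ≤ i ∧ i ≤ p) ∧ (1 ≤ j ∧ j ≤ p) ∧
      ∃ (z : V) (A : G.Walk ((P.take r).getVert l) z) (B : G.Walk z (P.getVert r)),
        (P.take r).drop l = A.append B ∧
        IsShortestIn G wt (lowVerts p U i) A ∧ IsShortestIn G wt (lowVerts p U j) B

end

end VSDO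

/-!
Let `A` be a shortest path of `G - D` and `a` a vertex of `A` of maximal level `i`. A walk of `G_i`
between the ends of `A` that is shorter than `A` has to meet `D`; following `A` from `a` back to its
start and then this walk, one gets from `a` to a failure within `2|A|` without touching `U_{i+1}`.
So in some tree of `𝒯_{U_{i+1}}(U_i)` the route from `a` via the root to that failure has length at
most `(2k - 1) · 2|A|`. The vertex just before this route first meets `D` is a trunk child or the
parent of a failure, hence lies in `V(H)`: the path `A` comes within `(4k - 2)|A|` of `V(H)`.

A segment of `P` is at most `ε₅` times as long as the part of `P` between any of its positions and
the nearer end of `P`, so that no piece of it comes this close to `V(H)` if `P` is `ε₁`-far away.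
The segment is cut by `v` into at most two shortest paths of `G - D`, to which this applies.
-/

namespace VSDO

section WalkLength

variable {V : Type*} {G : SimpleGraph V} {wt : Sym2 V → ℝ} {x y z : V}

theorem wlen_append (P : G.Walk x y) (Q : G.Walk y z) :
    wlen wt (P.append Q) = wlen wt P + wlen wt Q := by
  simp [wlen, Walk.edges_append]

theorem wlen_reverse (P : G.Walk x y) : wlen wt P.reverse = wlen wt P := by
  simp [wlen, Walk.edges_reverse, List.sum_reverse]

theorem wlen_mapLe {H : SimpleGraph V} (h : H ≤ G) (P : H.Walk x y) :
    wlen wt (P.mapLe h) = wlen wt P := by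
  simp only [wlen, Walk.edges_mapLe_eq_edges]

theorem wlen_take_add_wlen_drop (P : G.Walk x y) (i : ℕ) :
    wlen wt (P.take i) + wlen wt (P.drop i) = wlen wt P := by
  rw [← wlen_append, Walk.append_take_drop_eq]

theorem wlen_drop_take (P : G.Walk x y) {l r : ℕ} (hlr : l ≤ r) :
    wlen wt ((P.take r).drop l) = wlen wt (P.take r) - wlen wt (P.take l) := by
  have htake : wlen wt ((P.take r).take l) = wlen wt (P.take l) := by
    simp only [wlen, Walk.edges_take, List.take_take, min_eq_left hlr]
  linarith [wlen_take_add_wlen_drop (wt := wt) (P.take r) l]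

theorem wlen_pos (hwt : ∀ e ∈ G.edgeSet, 0 < wt e) {P : G.Walk x y} (hP : 0 < P.length) :
    0 < wlen wt P := by
  refine List.sum_pos _ (fun a ha => ?_) ?_
  · obtain ⟨e, he, rfl⟩ := List.mem_map.1 ha
    exact hwt e (P.edges_subset_edgeSet he)
  · rwa [← List.length_pos_iff, List.length_map, Walk.length_edges]

theorem wlen_le_of_edges_sublist (hwt : ∀ e ∈ G.edgeSet, 0 ≤ wt e) {x' y' : V} {P : G.Walk x y}
    {Q : G.Walk x' y'} (h : P.edges.Sublist Q.edges) : wlen wt P ≤ wlen wt Q := by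
  refine (h.map wt).sum_le_sum fun a ha => ?_
  obtain ⟨e, he, rfl⟩ := List.mem_map.1 ha
  exact hwt e (Q.edges_subset_edgeSet he)

theorem wlen_nonneg (hwt : ∀ e ∈ G.edgeSet, 0 ≤ wt e) (P : G.Walk x y) : 0 ≤ wlen wt P :=
  wlen_le_of_edges_sublist (P := (Walk.nil : G.Walk x x)) hwt (List.nil_sublist _)

theorem wlen_le_of_isSubwalk (hwt : ∀ e ∈ G.edgeSet, 0 ≤ wt e) {x' y' : V} {P : G.Walk x y}
    {Q : G.Walk x' y'} (h : P.IsSubwalk Q) : wlen wt P ≤ wlen wt Q :=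
  wlen_le_of_edges_sublist hwt h.edges_isInfix.sublist

end WalkLength

section Walk

variable {V : Type*} {G : SimpleGraph V} {x y : V}

theorem exists_getVert_eq_of_mem_support_drop_take {P : G.Walk x y} {l r : ℕ} (hlr : l ≤ r) {a : V}
    (ha : a ∈ ((P.take r).drop l).support) : ∃ m, l ≤ m ∧ m ≤ r ∧ P.getVert m = a := by
  obtain ⟨j, rfl, -⟩ := Walk.mem_support_iff_exists_getVert.1 ha
  refine ⟨min r (l + j), le_min hlr (Nat.le_add_right l j), min_le_left _ _, ?_⟩
  rw [Walk.drop_getVert, Walk.take_getVert]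

theorem exists_eq_append_of_append_eq_append {y' z : V} {A : G.Walk x y} {B : G.Walk y z}
    {A' : G.Walk x y'} {B' : G.Walk y' z} (h : A.append B = A'.append B')
    (hle : A.length ≤ A'.length) : ∃ E : G.Walk y y', A' = A.append E ∧ B = E.append B' := by
  induction A with
  | nil => exact ⟨A', rfl, h⟩
  | cons hadj A ih =>
    cases A' with
    | nil => simp at hle
    | cons hadj' A' =>
      obtain ⟨rfl, h⟩ : _ ∧ _ := by simpa only [Walk.cons_append, Walk.cons.injEq] using h
      obtain ⟨E, rfl, rfl⟩ := ih (eq_of_heq h) (by simpa using hle)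
      exact ⟨E, rfl, rfl⟩

theorem exists_last_exit {D : Set V} (P : G.Walk x y) (hy : y ∉ D) (hD : ∃ a ∈ P.support, a ∈ D) :
    ∃ (f g : V) (X : G.Walk x f) (h : G.Adj f g) (Y : G.Walk g y),
      P = X.append (Walk.cons h Y) ∧ f ∈ D ∧ ∀ a ∈ Y.support, a ∉ D := by
  induction P with
  | nil =>
    obtain ⟨a, ha, haD⟩ := hD
    exact absurd (Walk.mem_support_nil_iff.1 ha ▸ haD) hy
  | @cons x' _ _ h Q ih =>
    by_cases hQ : ∃ a ∈ Q.support, a ∈ D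
    · obtain ⟨f, g, X, h', Y, rfl, hf, hY⟩ := ih hy hQ
      exact ⟨f, g, Walk.cons h X, h', Y, rfl, hf, hY⟩
    · push Not at hQ
      obtain ⟨a, ha, haD⟩ := hD
      obtain rfl | ha := List.mem_cons.1 ha
      · exact ⟨_, _, Walk.nil, h, Q, rfl, haD, hQ⟩
      · exact absurd haD (hQ a ha)

theorem exists_first_entry {D : Set V} (P : G.Walk x y) (hx : x ∉ D)
    (hD : ∃ a ∈ P.support, a ∈ D) :
    ∃ (g f : V) (X : G.Walk x g) (h : G.Adj g f) (Y : G.Walk f y),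
      P = X.append (Walk.cons h Y) ∧ f ∈ D ∧ ∀ a ∈ X.support, a ∉ D := by
  obtain ⟨f, g, X, h, Y, hP, hf, hY⟩ := exists_last_exit P.reverse hx (by simpa using hD)
  refine ⟨g, f, Y.reverse, h.symm, X.reverse, ?_, hf, by simpa using hY⟩
  rw [← P.reverse_reverse, hP]
  simp [← Walk.append_assoc]

theorem exists_walk_wlen_le_add {wt : Sym2 V → ℝ} (hwt : ∀ e ∈ G.edgeSet, 0 ≤ wt e) {z : V}
    {P : G.Walk x y} {Q : G.Walk x z} {a b : V} (ha : a ∈ P.support) (hb : b ∈ Q.support) :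
    ∃ W : G.Walk a b, (∀ q ∈ W.support, q ∈ P.support ∨ q ∈ Q.support) ∧
      wlen wt W ≤ wlen wt P + wlen wt Q := by
  classical
  refine ⟨(P.takeUntil a ha).reverse.append (Q.takeUntil b hb), fun q hq => ?_, ?_⟩
  · rw [Walk.mem_support_append_iff, Walk.support_reverse, List.mem_reverse] at hq
    exact hq.imp (fun h => P.support_takeUntil_subset_support ha h)
      (fun h => Q.support_takeUntil_subset_support hb h)
  · rw [wlen_append, wlen_reverse]
    exact add_le_add (wlen_le_of_isSubwalk hwt (P.isSubwalk_takeUntil ha))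
      (wlen_le_of_isSubwalk hwt (Q.isSubwalk_takeUntil hb))

end Walk

section ShortestPath

variable {V : Type*} {G : SimpleGraph V} {wt : Sym2 V → ℝ} {A : Set V}

theorem exists_isShortestIn [Finite V] (hwt : ∀ e ∈ G.edgeSet, 0 ≤ wt e) {x y : V}
    (Q : G.Walk x y) (hQ : ∀ a ∈ Q.support, a ∈ A) : ∃ P : G.Walk x y, IsShortestIn G wt A P := by
  classical
  have := Fintype.ofFinite V
  let pathsIn : Set (G.Path x y) := {P | ∀ a ∈ (P : G.Walk x y).support, a ∈ A}
  have bypass_mem (R : G.Walk x y) (hR : ∀ a ∈ R.support, a ∈ A) :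
      ⟨R.bypass, R.bypass_isPath⟩ ∈ pathsIn :=
    fun a ha => hR a (R.support_bypass_subset_support ha)
  obtain ⟨P, hPA, hP⟩ := Set.exists_min_image pathsIn (fun P => wlen wt (P : G.Walk x y))
    (Set.toFinite _) ⟨_, bypass_mem Q hQ⟩
  exact ⟨P, hPA, fun R hR => (hP _ (bypass_mem R hR)).trans
    (wlen_le_of_edges_sublist hwt R.edges_bypass_sublist_edges)⟩

theorem IsShortestIn.of_isSubwalk {x y x' y' : V} {P : G.Walk x y} {Q : G.Walk x' y'}
    (hQ : IsShortestIn G wt A Q) (h : P.IsSubwalk Q) : IsShortestIn G wt A P := by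
  refine ⟨fun a ha => hQ.1 a (h.support_subset ha), fun R hR => ?_⟩
  obtain ⟨X, Y, rfl⟩ := h
  have hXRY : ∀ a ∈ ((X.append R).append Y).support, a ∈ A := by
    have hXPY := hQ.1
    simp only [Walk.mem_support_append_iff] at hXPY ⊢
    grind
  have hle := hQ.2 _ hXRY
  simp only [wlen_append] at hle
  linarith

theorem exists_eq_append_isShortestIn {u v w x y : V} {P₁ : G.Walk u v} {P₂ : G.Walk v w}
    (hP₁ : IsShortestIn G wt A P₁) (hP₂ : IsShortestIn G wt A P₂) {W : G.Walk x y}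
    (hW : W.IsSubwalk (P₁.append P₂)) :
    ∃ (z : V) (X : G.Walk x z) (Y : G.Walk z y),
      W = X.append Y ∧ IsShortestIn G wt A X ∧ IsShortestIn G wt A Y := by
  have of_isShortestIn (h : IsShortestIn G wt A W) : ∃ (z : V) (X : G.Walk x z) (Y : G.Walk z y),
      W = X.append Y ∧ IsShortestIn G wt A X ∧ IsShortestIn G wt A Y :=
    ⟨y, W, Walk.nil, W.append_nil.symm, h, h.of_isSubwalk ⟨W, Walk.nil, by simp⟩⟩
  obtain ⟨L, R, hLR⟩ := hW
  rw [← Walk.append_assoc] at hLR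
  obtain hL | hL := le_total L.length P₁.length
  · obtain ⟨E, rfl, hE⟩ := exists_eq_append_of_append_eq_append hLR.symm hL
    obtain hE' | hE' := le_total W.length E.length
    · obtain ⟨F, rfl, -⟩ := exists_eq_append_of_append_eq_append hE hE'
      exact of_isShortestIn (hP₁.of_isSubwalk ⟨L, F, L.append_assoc W F⟩)
    · obtain ⟨F, rfl, rfl⟩ := exists_eq_append_of_append_eq_append hE.symm hE'
      exact ⟨v, E, F, rfl, hP₁.of_isSubwalk ⟨L, Walk.nil, by simp⟩,
        hP₂.of_isSubwalk ⟨Walk.nil, R, rfl⟩⟩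
  · obtain ⟨E, rfl, rfl⟩ := exists_eq_append_of_append_eq_append hLR hL
    exact of_isShortestIn (hP₂.of_isSubwalk ⟨E, R, E.append_assoc W R⟩)

end ShortestPath

section TreeNeighbours

variable {V : Type*} {G : SimpleGraph V} {wt : Sym2 V → ℝ} {T : G.Subgraph} {S D : Set V} {r x : V}

theorem exists_trunk_child_near (hwt : ∀ e ∈ G.edgeSet, 0 ≤ wt e) (hr : r ∈ S) (hx : x ∈ S)
    (hxD : x ∉ D) {P : T.spanningCoe.Walk x r} (hP : P.IsPath) (hPD : ∃ a ∈ P.support, a ∈ D) :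
    ∃ f ∈ D, ∃ g, f ∈ T.verts ∧ IsParent T r g f ∧ g ∈ trunk T S ∧
      ∃ Q : T.spanningCoe.Walk x g, (∀ q ∈ Q.support, q ∉ D) ∧ wlen wt Q ≤ wlen wt P := by
  obtain ⟨g, f, X, h, Y, rfl, hf, hX⟩ := exists_first_entry P hxD hPD
  have hadj : T.Adj g f := h
  refine ⟨f, hf, g, hadj.snd_mem, ⟨_, hP.of_append_right, by simp, by simp⟩,
    ⟨hadj.fst_mem, x, hx, r, hr, _, hP, by simp⟩, X, hX, ?_⟩
  exact wlen_le_of_isSubwalk (fun e he => hwt e (edgeSet_mono T.spanningCoe_le he))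
    ⟨Walk.nil, _, rfl⟩

theorem exists_parent_near_root (hwt : ∀ e ∈ G.edgeSet, 0 ≤ wt e) (hrD : r ∉ D)
    {P : T.spanningCoe.Walk x r} (hP : P.IsPath) (hPD : ∃ a ∈ P.support, a ∈ D) :
    ∃ f ∈ D, ∃ g, f ∈ T.verts ∧ IsParent T r f g ∧
      ∃ Q : T.spanningCoe.Walk r g, (∀ q ∈ Q.support, q ∉ D) ∧ wlen wt Q ≤ wlen wt P := by
  obtain ⟨f, g, X, h, Y, rfl, hf, hY⟩ := exists_last_exit P hrD hPD
  have hadj : T.Adj f g := h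
  refine ⟨f, hf, g, hadj.fst_mem, ⟨_, hP.of_append_right, by simp, by simp⟩, Y.reverse,
    by simpa using hY, ?_⟩
  rw [wlen_reverse]
  exact wlen_le_of_isSubwalk (fun e he => hwt e (edgeSet_mono T.spanningCoe_le he))
    ⟨X.concat h, Walk.nil, by simp [Walk.concat_append]⟩

theorem exists_treeNbr_near (hwt : ∀ e ∈ G.edgeSet, 0 ≤ wt e) {f : V} {a b : ℝ} (hr : r ∈ S)
    (hx : x ∈ S) (hxD : x ∉ D) (hf : f ∈ D) (ha : HasDepth wt T r x a) (hb : HasDepth wt T r f b) :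
    ∃ f' ∈ D, f' ∈ T.verts ∧ ∃ g ∈ treeNbrs T S r f', ∃ Q : G.Walk x g,
      (∀ q ∈ Q.support, q ∉ D) ∧ wlen wt Q ≤ a + b := by
  obtain ⟨-, P, hP, rfl⟩ := ha
  obtain ⟨-, R, hR, rfl⟩ := hb
  have hR0 : 0 ≤ wlen wt R :=
    wlen_nonneg (fun e he => hwt e (edgeSet_mono T.spanningCoe_le he)) R
  by_cases hPD : ∃ q ∈ P.support, q ∈ D
  · obtain ⟨f', hf', g, hf'T, hgf, hgS, Q, hQ, hQP⟩ :=
      exists_trunk_child_near hwt hr hx hxD hP hPD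
    refine ⟨f', hf', hf'T, g, Or.inr ⟨hgf, hgS⟩, Q.mapLe T.spanningCoe_le, by simpa using hQ, ?_⟩
    rw [wlen_mapLe]
    linarith
  · push Not at hPD
    obtain ⟨f', hf', g, hf'T, hfg, Q, hQ, hQR⟩ :=
      exists_parent_near_root hwt (hPD r P.end_mem_support) hR ⟨f, R.start_mem_support, hf⟩
    refine ⟨f', hf', hf'T, g, Or.inl hfg, (P.append Q).mapLe T.spanningCoe_le, fun q hq => ?_, ?_⟩
    · rw [Walk.support_mapLe_eq_support, Walk.mem_support_append_iff] at hq
      exact hq.elim (hPD q) (hQ q)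
    · rw [wlen_mapLe, wlen_append]
      linarith

end TreeNeighbours

section Stretch

variable {V : Type*} {G : SimpleGraph V} {wt : Sym2 V → ℝ}

/-- The stretch condition of an `S`-restricted tree cover of `G - R`, for an arbitrary factor `σ` in
place of `2k - 1`. Comparing with all walks of `G - R` instead of the shortest ones frees the notion
from the existence of shortest walks. -/
def HasStretch (wt : Sym2 V → ℝ) (σ : ℝ) (R S : Set V) (T : V → G.Subgraph) : Prop :=
  ∀ x ∈ S, ∀ y, ∀ P : G.Walk x y, (∀ a ∈ P.support, a ∉ R) →
    ∃ r ∈ S, ∃ a b : ℝ, HasDepth wt (T r) r x a ∧ HasDepth wt (T r) r y b ∧ a + b ≤ σ * wlen wt P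

theorem IsTreeCover.hasStretch [Fintype V] (hwt : ∀ e ∈ G.edgeSet, 0 ≤ wt e)
    (hk : 0 ≤ 2 * kpar V - 1) {R S : Set V} {T : V → G.Subgraph} (hT : IsTreeCover G wt R S T) :
    HasStretch wt (2 * kpar V - 1) R S T := by
  intro x hx y P hP
  obtain ⟨P', hP'⟩ := exists_isShortestIn (A := Rᶜ) hwt P hP
  obtain ⟨r, hr, a, b, ha, hb, hab⟩ := hT.stretch x hx y P' hP'
  exact ⟨r, hr, a, b, ha, hb, hab.trans (mul_le_mul_of_nonneg_left (hP'.2 P hP) hk)⟩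

theorem one_lt_kpar [Fintype V] (hn : 3 ≤ Fintype.card V) : 1 < kpar V := by
  have hn' : (3 : ℝ) ≤ Fintype.card V := by exact_mod_cast hn
  rw [kpar, Real.lt_log_iff_exp_lt (by positivity)]
  linarith [Real.exp_one_lt_d9]

end Stretch

section Level

variable {V : Type*} {p : ℕ} {U : ℕ → Set V}

theorem level_spec (hroot : U 1 = Set.univ) (hlast : U (p + 1) = ∅) (v : V) :
    1 ≤ level p U v ∧ level p U v ≤ p ∧ v ∈ U (level p U v) := by
  have hv : v ∈ U 1 := hroot ▸ Set.mem_univ v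
  have hp : p ≠ 0 := by
    rintro rfl
    simp [hlast] at hv
  exact Nat.sSup_mem (s := {l | 1 ≤ l ∧ l ≤ p ∧ v ∈ U l})
    ⟨1, le_rfl, Nat.one_le_iff_ne_zero.2 hp, hv⟩ ⟨p, fun _ h => h.2.1⟩

theorem lowVerts_subset_compl (hlast : U (p + 1) = ∅) {i : ℕ} (hi : i ≤ p) :
    lowVerts p U i ⊆ (U (i + 1))ᶜ := by
  intro v (hv : level p U v ≤ i) hvU
  obtain hlt | rfl := hi.lt_or_eq
  · have : i + 1 ≤ level p U v := le_csSup ⟨p, fun _ h => h.2.1⟩ ⟨Nat.succ_pos i, hlt, hvU⟩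
    lia
  · simp [hlast] at hvU

end Level

section Remote

variable {V : Type*} {G : SimpleGraph V} {wt : Sym2 V → ℝ} {D X : Set V} {K : ℝ} {x y : V}

/-- Every walk of `G - D` from a vertex of `A` to `X` is longer than `K * |A|`. In contrast to
`FarAway`, the bound is the same for all vertices of `A`, and the ends of `A` are included; this
makes the notion hereditary. -/
def IsRemote (wt : Sym2 V → ℝ) (D X : Set V) (K : ℝ) (A : G.Walk x y) : Prop :=
  ∀ a ∈ A.support, ∀ z ∈ X, ∀ Q : G.Walk a z, (∀ q ∈ Q.support, q ∉ D) →
    K * wlen wt A < wlen wt Q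

theorem IsRemote.of_isSubwalk (hwt : ∀ e ∈ G.edgeSet, 0 ≤ wt e) (hK : 0 ≤ K) {x' y' : V}
    {A : G.Walk x y} {B : G.Walk x' y'} (hB : IsRemote wt D X K B) (h : A.IsSubwalk B) :
    IsRemote wt D X K A :=
  fun a ha z hz Q hQ => (mul_le_mul_of_nonneg_left (wlen_le_of_isSubwalk hwt h) hK).trans_lt
    (hB a (h.support_subset ha) z hz Q hQ)

theorem IsShortestIn.exists_lowVerts_of_isRemote (hwt : ∀ e ∈ G.edgeSet, 0 ≤ wt e)
    {cov : Set V → Set V → V → G.Subgraph} {p : ℕ} {U : ℕ → Set V} (hroot : U 1 = Set.univ)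
    (hlast : U (p + 1) = ∅) {σ : ℝ} (hσ : 0 ≤ σ)
    (hcov : ∀ i ∈ Set.Icc 1 p, HasStretch wt σ (U (i + 1)) (U i \ U (i + 1))
      (cov (U (i + 1)) (U i \ U (i + 1))))
    (hX : (⋃ f ∈ D, failNbrs cov p U f) \ D ⊆ X) {A : G.Walk x y} (hA : IsShortestIn G wt Dᶜ A)
    (hremote : IsRemote wt D X (2 * σ) A) :
    ∃ i, (1 ≤ i ∧ i ≤ p) ∧ IsShortestIn G wt (lowVerts p U i) A := by
  classical
  obtain ⟨a, ha, hmax⟩ := A.support.toFinset.exists_max_image (level p U) ⟨x, by simp⟩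
  simp only [List.mem_toFinset] at ha hmax
  obtain ⟨hi1, hip, haU⟩ := level_spec hroot hlast a
  set i := level p U a
  have hlow : lowVerts p U i ⊆ (U (i + 1))ᶜ := lowVerts_subset_compl hlast hip
  refine ⟨i, ⟨hi1, hip⟩, hmax, fun Q hQ => ?_⟩
  by_contra! hQA
  obtain ⟨f, hfQ, hfD⟩ : ∃ f ∈ Q.support, f ∈ D := by
    by_contra! hQD
    exact hQA.not_ge (hA.2 Q hQD)
  obtain ⟨W, hWsupp, hWlen⟩ := exists_walk_wlen_le_add hwt ha hfQ
  have haS : a ∈ U i \ U (i + 1) := ⟨haU, hlow (le_refl i)⟩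
  obtain ⟨r, hr, α, β, hα, hβ, hαβ⟩ := hcov i ⟨hi1, hip⟩ a haS f W fun q hq =>
    hlow ((hWsupp q hq).elim (hmax q) (hQ q))
  obtain ⟨f', hf'D, hf'T, g, hg, R, hR, hRlen⟩ :=
    exists_treeNbr_near hwt hr haS (hA.1 a ha) hfD hα hβ
  have hgX : g ∈ X :=
    hX ⟨Set.mem_biUnion hf'D ⟨i, hi1, hip, r, hr, hf'T, hg⟩, hR g R.end_mem_support⟩
  refine (hremote a ha g hgX R hR).not_ge ?_
  calc wlen wt R ≤ α + β := hRlen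
    _ ≤ σ * wlen wt W := hαβ
    _ ≤ σ * (2 * wlen wt A) := mul_le_mul_of_nonneg_left (by linarith) hσ
    _ = 2 * σ * wlen wt A := by ring

end Remote

section Segment

variable {V : Type*} {G : SimpleGraph V} {wt : Sym2 V → ℝ} {x y : V} {P : G.Walk x y}

theorem lt_mul_of_floor_logb_eq {β a b : ℝ} (hβ : 1 < β) (ha : 0 < a) (hb : 0 < b)
    (h : ⌊Real.logb β a⌋ = ⌊Real.logb β b⌋) : b < β * a := by
  rw [← Real.logb_lt_logb_iff hβ hb (by positivity), Real.logb_mul (by positivity) ha.ne',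
    Real.logb_self_eq_one hβ]
  linarith [(abs_lt.1 (Int.abs_sub_lt_one_of_floor_eq_floor h)).1]

theorem SameSegment.wlen_le (hwt : ∀ e ∈ G.edgeSet, 0 < wt e) {ε : ℝ} (hε : 0 < ε) {l r m : ℕ}
    (h : SameSegment wt ε P l r) (hlm : l ≤ m) (hmr : m ≤ r) :
    wlen wt ((P.take r).drop l) ≤ ε * min (wlen wt (P.take m)) (wlen wt (P.drop m)) := by
  have hwt' : ∀ e ∈ G.edgeSet, 0 ≤ wt e := fun e he => (hwt e he).le
  obtain ⟨⟨hl0, hlP⟩, ⟨hr0, hrP⟩, h⟩ := h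
  have take_pos {i : ℕ} (h0 : 0 < i) (hi : i < P.length) : 0 < wlen wt (P.take i) :=
    wlen_pos hwt (by rw [Walk.take_length]; exact lt_min h0 (h0.trans hi))
  have drop_pos {i : ℕ} (hi : i < P.length) : 0 < wlen wt (P.drop i) :=
    wlen_pos hwt (by rw [Walk.drop_length]; exact Nat.sub_pos_of_lt hi)
  have hlm' : wlen wt (P.take l) ≤ wlen wt (P.take m) :=
    wlen_le_of_isSubwalk hwt' (P.take_isSubwalk_take hlm)
  have hmr' : wlen wt (P.take m) ≤ wlen wt (P.take r) :=
    wlen_le_of_isSubwalk hwt' (P.take_isSubwalk_take hmr)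
  have hsum (i : ℕ) := wlen_take_add_wlen_drop (wt := wt) P i
  rw [wlen_drop_take P (hlm.trans hmr)]
  rcases h with ⟨-, hhalf, hfloor⟩ | ⟨hhalf, -, hfloor⟩
  · have hlt := lt_mul_of_floor_logb_eq (by linarith) (take_pos hl0 hlP) (take_pos hr0 hrP) hfloor
    calc wlen wt (P.take r) - wlen wt (P.take l) ≤ ε * wlen wt (P.take l) := by linarith
      _ ≤ ε * min (wlen wt (P.take m)) (wlen wt (P.drop m)) := by
        gcongr
        exact le_min hlm' (by linarith [hsum m])
  · have hlt := lt_mul_of_floor_logb_eq (by linarith) (drop_pos hrP) (drop_pos hlP) hfloor.symm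
    calc wlen wt (P.take r) - wlen wt (P.take l) ≤ ε * wlen wt (P.drop r) := by
          linarith [hsum l, hsum r]
      _ ≤ ε * min (wlen wt (P.take m)) (wlen wt (P.drop m)) := by
        gcongr
        exact le_min (by linarith [hsum l, hsum r]) (by linarith [hsum m, hsum r])

theorem FarAway.lt_wlen [Finite V] (hwt : ∀ e ∈ G.edgeSet, 0 ≤ wt e) {D X : Set V} {ε : ℝ}
    (hfar : FarAway wt D X ε P) {m : ℕ} (hm0 : 0 < m) (hmP : m < P.length) {z : V} (hz : z ∈ X)
    (Q : G.Walk (P.getVert m) z) (hQ : ∀ q ∈ Q.support, q ∉ D) :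
    ε * min (wlen wt (P.take m)) (wlen wt (P.drop m)) < wlen wt Q := by
  by_contra! hle
  obtain ⟨Q', hQ'⟩ := exists_isShortestIn (A := Dᶜ) hwt Q hQ
  exact hfar ⟨m, hm0, hmP, z, hz, Q', hQ', (hQ'.2 Q hQ).trans hle⟩

theorem FarAway.isRemote_drop_take [Finite V] (hwt : ∀ e ∈ G.edgeSet, 0 < wt e) {D X : Set V}
    {ε₁ ε₅ K : ℝ} (hfar : FarAway wt D X ε₁ P) (hε₅ : 0 < ε₅) (hK : 0 ≤ K) (hε : K * ε₅ ≤ ε₁)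
    {l r : ℕ} (hseg : SameSegment wt ε₅ P l r) (hlr : l ≤ r) :
    IsRemote wt D X K ((P.take r).drop l) := by
  have hwt' : ∀ e ∈ G.edgeSet, 0 ≤ wt e := fun e he => (hwt e he).le
  intro a ha z hz Q hQ
  obtain ⟨m, hlm, hmr, rfl⟩ := exists_getVert_eq_of_mem_support_drop_take hlr ha
  have hmin : 0 ≤ min (wlen wt (P.take m)) (wlen wt (P.drop m)) :=
    le_min (wlen_nonneg hwt' _) (wlen_nonneg hwt' _)
  calc K * wlen wt ((P.take r).drop l)
      ≤ K * (ε₅ * min (wlen wt (P.take m)) (wlen wt (P.drop m))) :=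
        mul_le_mul_of_nonneg_left (hseg.wlen_le hwt hε₅ hlm hmr) hK
    _ = K * ε₅ * min (wlen wt (P.take m)) (wlen wt (P.drop m)) := (mul_assoc _ _ _).symm
    _ ≤ ε₁ * min (wlen wt (P.take m)) (wlen wt (P.drop m)) := mul_le_mul_of_nonneg_right hε hmin
    _ < wlen wt Q :=
        hfar.lt_wlen hwt' (hseg.1.1.trans_le hlm) (hmr.trans_lt hseg.2.1.2) hz Q hQ

end Segment

end VSDO

theorem mainTheorem5_general {V : Type*} [Finite V] {G : SimpleGraph V} {wt : Sym2 V → ℝ}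
    (hwt : ∀ e ∈ G.edgeSet, 0 < wt e) {cov : Set V → Set V → V → G.Subgraph} {p : ℕ}
    {U : ℕ → Set V} (hroot : U 1 = Set.univ) (hlast : U (p + 1) = ∅) {σ : ℝ} (hσ : 0 ≤ σ)
    (hcov : ∀ i ∈ Set.Icc 1 p, VSDO.HasStretch wt σ (U (i + 1)) (U i \ U (i + 1))
      (cov (U (i + 1)) (U i \ U (i + 1))))
    {D X : Set V} (hX : (⋃ f ∈ D, VSDO.failNbrs cov p U f) \ D ⊆ X)
    {ε₁ ε₅ : ℝ} (hε₅ : 0 < ε₅) (hε : 2 * σ * ε₅ ≤ ε₁)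
    {u v w : V} {P₁ : G.Walk u v} {P₂ : G.Walk v w}
    (hP₁ : VSDO.IsShortestIn G wt Dᶜ P₁) (hP₂ : VSDO.IsShortestIn G wt Dᶜ P₂)
    (hfar : VSDO.FarAway wt D X ε₁ (P₁.append P₂)) :
    VSDO.IsSegmentBipath wt p U ε₅ (P₁.append P₂) := by
  have hwt' : ∀ e ∈ G.edgeSet, 0 ≤ wt e := fun e he => (hwt e he).le
  have hK : 0 ≤ 2 * σ := by positivity
  intro l r ⟨hseg, hext⟩
  have hremote := hfar.isRemote_drop_take hwt hε₅ hK hε hseg (hext r hseg).1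
  obtain ⟨z, A, B, hAB, hA, hB⟩ := VSDO.exists_eq_append_isShortestIn hP₁ hP₂
    ((Walk.isSubwalk_drop _ l).trans ((P₁.append P₂).isSubwalk_take r))
  obtain ⟨i, hi, hAi⟩ := hA.exists_lowVerts_of_isRemote hwt' hroot hlast hσ hcov hX
    (hremote.of_isSubwalk hwt' hK ⟨Walk.nil, B, hAB⟩)
  obtain ⟨j, hj, hBj⟩ := hB.exists_lowVerts_of_isRemote hwt' hroot hlast hσ hcov hX
    (hremote.of_isSubwalk hwt' hK ⟨A, Walk.nil, by simp [hAB]⟩)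
  exact ⟨i, j, hi, hj, z, A, B, hAB, hAi, hBj⟩

theorem mainTheorem5 {V : Type*} [Fintype V] (hn : 3 ≤ Fintype.card V)
    (G : SimpleGraph V) (wt : Sym2 V → ℝ) (hwt : ∀ e ∈ G.edgeSet, 1 ≤ wt e)
    (d : ℕ) (hd : 2 ≤ d) (c : ℝ) (hc : 1 ≤ c)
    (cov : Set V → Set V → V → G.Subgraph) (hcov : VSDO.IsCoverChoice G wt cov)
    (p : ℕ) (U : ℕ → Set V) (hU : VSDO.IsHierarchyPath d c cov p U)
    (D : Set V) (hD : D.ncard ≤ d) (s t : V)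
    (ε ε₁ ε₅ : ℝ) (hε : 0 < ε) (hε₁ : ε₁ = ε / (2 + ε))
    (hε₅ : ε₅ = ε₁ / (4 * VSDO.kpar V - 2))
    (u v w : V) (P₁ : G.Walk u v) (P₂ : G.Walk v w)
    (hP₁ : VSDO.IsShortestIn G wt Dᶜ P₁) (hP₂ : VSDO.IsShortestIn G wt Dᶜ P₂)
    (hfar : VSDO.FarAway wt D (VSDO.auxVerts cov p U D s t) ε₁ (P₁.append P₂)) :
    VSDO.IsSegmentBipath wt p U ε₅ (P₁.append P₂) := by
  have hwt' : ∀ e ∈ G.edgeSet, 0 < wt e := fun e he => one_pos.trans_le (hwt e he)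
  have hk : 0 < 2 * VSDO.kpar V - 1 := by linarith [VSDO.one_lt_kpar hn]
  obtain rfl : ε₅ = ε₁ / (2 * (2 * VSDO.kpar V - 1)) := by rw [hε₅]; ring_nf
  exact mainTheorem5_general hwt' hU.root hU.last hk.le
    (fun i _ => (hcov _ _ Set.disjoint_sdiff_left).hasStretch (fun e he => (hwt' e he).le) hk.le)
    (Set.sdiff_subset_sdiff_left Set.subset_union_right) (by rw [hε₁]; positivity)
    (mul_div_cancel₀ _ (by positivity)).le hP₁ hP₂ hfar
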